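/- **Convergence of bounded integrals.** Let $\beta<1$ be a real number and let $p:\mathbb N\to(0,1]$ satisfy $Np(N)\to\infty$ as $N\to\infty$. Let $\varepsilon_{N,i,j}$, $(N,i,j)\in\mathbb N^3$, be independent $\{0,1\}$-valued random variables, realised as the coordinates of the product probability space $(\Omega_\varepsilon,\mathcal A_\varepsilon,\mathbb P_\varepsilon)$, with $\mathbb P_\varepsilon(\varepsilon_{N,i,j}=1)=p(N)$; thus $\varepsilon_{N,i,j}$ indicates a directed edge from $i$ to $j$ in the $N$-th random graph. For $N\ge 1$ let $\mathcal X_N=\{-1,+1\}^N$ and define on $\mathcal X_N$ the Curie–Weiss measure and, for each graph realisation, the Bovier–Gayrard (diluted Curie–Weiss) measure by $$\mathbb P_N^{(CW)}(\mathbf x)=\frac{\exp\Big(\frac{\beta}{2N}\sum_{i,j=1}^N x_ix_j\Big)}{\sum_{\mathbf y\in\mathcal X_N}\exp\Big(\frac{\beta}{2N}\sum_{i,j=1}^N y_iy_j\Big)},\qquad \mathbb P_N^{(BG)}(\mathbf x)=\frac{\exp\Big(\frac{\beta}{2Np(N)}\sum_{i,j=1}^N\varepsilon_{N,i,j}x_ix_j\Big)}{\sum_{\mathbf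 y\in\mathcal X_N}\exp\Big(\frac{\beta}{2Np(N)}\sum_{i,j=1}^N\varepsilon_{N,i,j}y_iy_j\Big)}.$$ For $g:\mathcal X_N\to\mathbb R$ write $E_N^{(P,CW)}(g)=\sum_{\mathbf x\in\mathcal X_N}g(\mathbf x)\,\mathbb P_N^{(CW)}(\mathbf x)$ and $E_N^{(P,BG)}(g)=\sum_{\mathbf x\in\mathcal X_N}g(\mathbf x)\,\mathbb P_N^{(BG)}(\mathbf x)$; the latter is a random variable on $\Omega_\varepsilon$. Let $f_N:\mathcal X_N\to\mathbb R$ be functions with $|f_N|<M$ for all $N$ and some constant $M\in\mathbb R$, and let $f_N^+=\max(f_N,0)$ and $f_N^-=\max(-f_N,0)$. Assume that $\lim_{N\to\infty}E_N^{(P,CW)}(f_N^+)$ and $\lim_{N\to\infty}E_N^{(P,CW)}(f_N^-)$ both exist and are finite. Then $\lim_{N\to\infty}E_N^{(P,CW)}(f_N)$ exists and is finite, and $$E_N^{(P,BG)}(f_N)\;\longrightarrow\;\lim_{N\to\infty}E_N^{(P,CW)}(f_N)\qquad\text{in }\mathbb P_\varepsilon\text{-probability as }N\to\infty.$$ -/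

import Mathlib

open MeasureTheory ProbabilityTheory Filter Topology

noncomputable section

namespace DilutedCurieWeiss

/-- Spin configurations on `N` nodes. A spin is a unit of `ℤ`, that is, `-1` or `+1`. -/
abbrev Config (N : ℕ) : Type := Fin N → ℤˣ

/-- The real number `x_i * x_j`. -/
def bond {N : ℕ} (x : Config N) (i j : Fin N) : ℝ :=
  ((x i : ℤ) : ℝ) * ((x j : ℤ) : ℝ)

/-- Realisations of the whole sequence of directed random graphs: `ω (N, i, j) = true` means that
the `N`-th graph has an edge from node `i` to node `j`. -/
abbrev Graphs : Type := ℕ × ℕ × ℕ → Bool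

/-- The product measure on graph sequences under which all edges are independent and an edge of
the `N`-th graph is present with probability `p N`. -/
def graphMeasure (p : ℕ → unitInterval) : Measure Graphs :=
  Measure.infinitePi fun e : ℕ × ℕ × ℕ => bernoulliMeasure true false (p e.1)

instance instIsProbabilityMeasureGraphMeasure (p : ℕ → unitInterval) :
    IsProbabilityMeasure (graphMeasure p) := by
  unfold graphMeasure
  infer_instance

/-- The edge indicator `ε_{N,i,j} ∈ {0, 1}`. -/
def edge (ω : Graphs) (N : ℕ) (i j : Fin N) : ℝ :=
  if ω (N, (i : ℕ), (j : ℕ)) = true then 1 else 0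

/-- Unnormalised Curie–Weiss weight. -/
def cwWeight (β : ℝ) (N : ℕ) (x : Config N) : ℝ :=
  Real.exp (β / (2 * (N : ℝ)) * ∑ i, ∑ j, bond x i j)

/-- Curie–Weiss partition function. -/
def cwPartition (β : ℝ) (N : ℕ) : ℝ :=
  ∑ x : Config N, cwWeight β N x

/-- Curie–Weiss probability of a configuration. -/
def cwProb (β : ℝ) (N : ℕ) (x : Config N) : ℝ :=
  cwWeight β N x / cwPartition β N

/-- Expectation under the Curie–Weiss measure. -/
def cwExp (β : ℝ) (N : ℕ) (g : Config N → ℝ) : ℝ :=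
  ∑ x : Config N, g x * cwProb β N x

/-- Unnormalised Bovier–Gayrard weight for the graph realisation `ω`. -/
def bgWeight (β : ℝ) (p : ℕ → unitInterval) (N : ℕ) (ω : Graphs) (x : Config N) : ℝ :=
  Real.exp (β / (2 * (N : ℝ) * (p N : ℝ)) * ∑ i, ∑ j, edge ω N i j * bond x i j)

/-- Bovier–Gayrard partition function for the graph realisation `ω`. -/
def bgPartition (β : ℝ) (p : ℕ → unitInterval) (N : ℕ) (ω : Graphs) : ℝ :=
  ∑ x : Config N, bgWeight β p N ω x

/-- Bovier–Gayrard probability of a configuration for the graph realisation `ω`. -/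
def bgProb (β : ℝ) (p : ℕ → unitInterval) (N : ℕ) (ω : Graphs) (x : Config N) : ℝ :=
  bgWeight β p N ω x / bgPartition β p N ω

/-- Expectation under the Bovier–Gayrard measure for the graph realisation `ω`. -/
def bgExp (β : ℝ) (p : ℕ → unitInterval) (N : ℕ) (ω : Graphs) (g : Config N → ℝ) : ℝ :=
  ∑ x : Config N, g x * bgProb β p N ω x

end DilutedCurieWeiss

end

/-!
Write `γ = β / (2 N p)`, where `p = p N`, and `t = tanh γ`. For an edge indicator `ε ∈ {0, 1}` and a
bond `s ∈ {-1, 1}` one has `exp (γ ε s) = cosh γ ^ ε * (1 + ε t s)`. The factors `cosh γ ^ ε` are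
random, and their product may fluctuate wildly when `p N` is small, but they do not depend on the
spins and cancel in quenched expectations (`bgExp_eq`). What remains, suitably normalised, is
`reducedWeight`; its first two moments are explicit because the edges are independent.

* The mean of the reduced weight of `x` is the Curie–Weiss weight at the inverse temperature
  `effectiveBeta = 2 N artanh (p t) = β + O(1 / (N p))` (`integral_reducedWeight`,
  `parameter_bounds`).
* The two-point function at `x, y` is at most the product of the means times
  `exp (η * energy (x * y) + δ)` with `η, δ = O(1 / (N p))`
  (`integral_reducedWeight_mul_le`), so correlations are governed by the overlap `∑ i, x i * y i`.

Both errors are controlled by exponential moments of the energy `(∑ i, x i) ^ 2 / (2 N)` under the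
uniform measure. For `a < 1` the mean of `exp (a * energy)` is bounded in `N`: this follows by
linearising the square with a Gaussian integral (`exists_sum_exp_energy_le`), and it is where
`β < 1` enters. Reduced partition sums are therefore close to Curie–Weiss partition sums in mean
square, relative to `2 ^ N` (`exists_integral_sq_sum_le`), and `2 ^ N` is at most a constant times
the Curie–Weiss partition function (`exists_le_cwPartition`). Since quenched expectations of
bounded functions are bounded, the difference of the two expectations is dominated by these
deviations without any control on the random partition function from below
(`abs_sum_div_sum_sub_le`), and Chebyshev's inequality yields convergence in probability
(`tendstoInMeasure_bgExp_sub_cwExp`).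
-/

namespace DilutedCurieWeiss

/-! ### Exponential moments of the Curie–Weiss energy -/

/-- Total spin of a configuration. -/
noncomputable def totalSpin {N : ℕ} (x : Config N) : ℝ := ∑ i, ((x i : ℤ) : ℝ)

/-- The mean-field energy `(∑ i, x i) ^ 2 / (2 * N)`; it is `0` on the empty configuration. -/
noncomputable def energy {N : ℕ} (x : Config N) : ℝ := totalSpin x ^ 2 / (2 * (N : ℝ))

lemma energy_nonneg {N : ℕ} (x : Config N) : 0 ≤ energy x := by
  unfold energy; positivity

lemma sum_bond {N : ℕ} (x : Config N) : ∑ i, ∑ j, bond x i j = totalSpin x ^ 2 := by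
  simp [bond, totalSpin, sq, Finset.sum_mul_sum]

lemma bond_mul_bond {N : ℕ} (x y : Config N) (i j : Fin N) :
    bond x i j * bond y i j = bond (x * y) i j := by
  simp [bond]; ring

lemma bond_eq_one_or {N : ℕ} (x : Config N) (i j : Fin N) :
    bond x i j = 1 ∨ bond x i j = -1 := by
  rcases Int.units_eq_one_or (x i) with h | h <;> rcases Int.units_eq_one_or (x j) with h' | h' <;>
    simp [bond, h, h']

lemma cwWeight_eq (β : ℝ) (N : ℕ) (x : Config N) : cwWeight β N x = Real.exp (β * energy x) := by
  rw [cwWeight, sum_bond, energy]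
  congr 1
  ring

lemma card_config (N : ℕ) : ∑ _x : Config N, (1 : ℝ) = 2 ^ N := by
  simp

lemma integrable_exp_sq_gaussianReal {a : ℝ} (ha : a < 1) :
    Integrable (fun g : ℝ => Real.exp (a * g ^ 2 / 2)) (gaussianReal 0 1) := by
  rw [gaussianReal_of_var_ne_zero _ one_ne_zero,
    integrable_withDensity_iff_integrable_smul' (measurable_gaussianPDF 0 1)
      (ae_of_all _ fun _ => gaussianPDF_lt_top)]
  have h := (integrable_exp_neg_mul_sq (b := (1 - a) / 2) (by linarith)).const_mul
    (√(2 * Real.pi * (1 : NNReal)))⁻¹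
  refine h.congr (ae_of_all _ fun g => ?_)
  beta_reduce
  rw [toReal_gaussianPDF, gaussianPDFReal, smul_eq_mul, mul_assoc _ (Real.exp _), ← Real.exp_add]
  congr 2
  simp
  ring

lemma sum_exp_mul_totalSpin (N : ℕ) (a : ℝ) :
    ∑ x : Config N, Real.exp (a * totalSpin x) = (2 * Real.cosh a) ^ N := by
  have h : 2 * Real.cosh a = ∑ s : ℤˣ, Real.exp (a * ((s : ℤ) : ℝ)) := by
    rw [UnitsInt.univ, Finset.sum_pair (by decide), Real.cosh_eq]
    simp; ring
  rw [h, Fintype.sum_pow]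
  simp [totalSpin, Finset.mul_sum, Real.exp_sum]

/-- Below the critical temperature parameter `1`, exponential moments of the energy under the
uniform measure are bounded uniformly in `N`. The square in the energy is linearised by a
Gaussian integral, after which the spins decouple. -/
lemma exists_sum_exp_energy_le {a : ℝ} (ha0 : 0 ≤ a) (ha : a < 1) :
    ∃ C : ℝ, 0 < C ∧ ∀ N : ℕ, ∑ x : Config N, Real.exp (a * energy x) ≤ C * 2 ^ N := by
  have hI := integrable_exp_sq_gaussianReal ha
  refine ⟨∫ g, Real.exp (a * g ^ 2 / 2) ∂gaussianReal 0 1, ?_, fun N => ?_⟩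
  · exact integral_exp_pos hI
  set c : ℝ := √(a / N) with hc
  have hc2 : c ^ 2 = a / N := Real.sq_sqrt (by positivity)
  have hlin : ∀ x : Config N, Real.exp (a * energy x) =
      ∫ g, Real.exp (c * totalSpin x * g) ∂gaussianReal 0 1 := by
    intro x
    have h := congrFun (mgf_id_gaussianReal (μ := 0) (v := 1)) (c * totalSpin x)
    simp only [mgf, id] at h
    rw [h, energy]
    congr 1
    rw [mul_pow, hc2]
    simp
    ring
  simp_rw [hlin]
  rw [← integral_finsetSum _ fun x _ => integrable_exp_mul_gaussianReal _, ← integral_mul_const]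
  refine integral_mono (integrable_finsetSum _ fun x _ => integrable_exp_mul_gaussianReal _)
    (hI.mul_const _) fun g => ?_
  have h1 : ∀ x : Config N, c * totalSpin x * g = (c * g) * totalSpin x := fun x => by ring
  simp_rw [h1]
  rw [sum_exp_mul_totalSpin, mul_pow, mul_comm]
  gcongr
  calc Real.cosh (c * g) ^ N ≤ Real.exp ((c * g) ^ 2 / 2) ^ N := by
        gcongr
        exact Real.cosh_le_exp_half_sq _
    _ = Real.exp ((N : ℝ) * (a / N) * g ^ 2 / 2) := by
        rw [← Real.exp_nat_mul, mul_pow, hc2]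
        congr 1; ring
    _ ≤ Real.exp (a * g ^ 2 / 2) := by
        gcongr
        rcases Nat.eq_zero_or_pos N with rfl | hN
        · simpa using ha0
        · field_simp; rfl

/-- The partition function is at least of order `2 ^ N`, also for negative `β`, by Jensen's
inequality in tangent-line form. -/
lemma exists_le_cwPartition (β : ℝ) :
    ∃ c : ℝ, 0 < c ∧ ∀ N : ℕ, c * 2 ^ N ≤ cwPartition β N := by
  obtain ⟨C, hC, hCN⟩ := exists_sum_exp_energy_le (a := 1 / 2) (by norm_num) (by norm_num)
  -- the mean energy is at most `2 * C`, because `z ≤ 2 * exp (z / 2)`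
  refine ⟨Real.exp (-(|β| * (2 * C))), Real.exp_pos _, fun N => ?_⟩
  have hE : ∑ x : Config N, energy x ≤ 2 * C * 2 ^ N := by
    calc ∑ x : Config N, energy x ≤ ∑ x : Config N, 2 * Real.exp (1 / 2 * energy x) := by
          gcongr with x
          linarith [Real.add_one_le_exp (1 / 2 * energy x)]
      _ ≤ 2 * C * 2 ^ N := by
          rw [← Finset.mul_sum]
          linarith [hCN N]
  have hpt : ∀ x : Config N, Real.exp (-(|β| * (2 * C))) * (1 + |β| * (2 * C) - |β| * energy x)
      ≤ cwWeight β N x := by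
    intro x
    rw [cwWeight_eq]
    calc _ ≤ Real.exp (-(|β| * (2 * C))) * Real.exp (|β| * (2 * C) - |β| * energy x) := by
          gcongr
          linarith [Real.add_one_le_exp (|β| * (2 * C) - |β| * energy x)]
      _ = Real.exp (-|β| * energy x) := by rw [← Real.exp_add]; congr 1; ring
      _ ≤ _ := by
          gcongr
          · exact energy_nonneg x
          · exact neg_abs_le β
  refine le_trans ?_ (Finset.sum_le_sum fun x _ => hpt x)
  rw [← Finset.mul_sum, Finset.sum_sub_distrib, ← Finset.mul_sum]
  gcongr
  have : ∑ _x : Config N, (1 + |β| * (2 * C)) = (1 + |β| * (2 * C)) * 2 ^ N := by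
    rw [← card_config, Finset.mul_sum, mul_one]
  rw [this]
  nlinarith [mul_le_mul_of_nonneg_left hE (abs_nonneg β)]

lemma cwPartition_pos (β : ℝ) (N : ℕ) : 0 < cwPartition β N :=
  Finset.sum_pos (fun _ _ => Real.exp_pos _) Finset.univ_nonempty

lemma abs_exp_sub_one_le_mul_exp_abs (z : ℝ) : |Real.exp z - 1| ≤ |z| * Real.exp |z| := by
  have h1 : 1 ≤ Real.exp |z| := Real.one_le_exp (abs_nonneg z)
  rw [abs_le]
  constructor
  · nlinarith [Real.add_one_le_exp z, neg_abs_le z, abs_nonneg z]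
  · have h2 : Real.exp z * Real.exp (-z) = 1 := by rw [← Real.exp_add]; simp
    have h3 : Real.exp z - 1 ≤ z * Real.exp z := by
      nlinarith [Real.add_one_le_exp (-z), Real.exp_pos z]
    refine h3.trans ?_
    gcongr <;> exact le_abs_self z

lemma abs_exp_mul_sub_one_le {κ ζ y : ℝ} (hκ : 0 < κ) (hζ : |ζ| ≤ κ) (hy : 0 ≤ y) :
    |Real.exp (ζ * y) - 1| ≤ |ζ| / κ * Real.exp (2 * κ * y) := by
  refine (abs_exp_sub_one_le_mul_exp_abs _).trans ?_
  rw [abs_mul, abs_of_nonneg hy]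
  have h1 : κ * y ≤ Real.exp (κ * y) := by linarith [Real.add_one_le_exp (κ * y)]
  have h2 : Real.exp (|ζ| * y) ≤ Real.exp (κ * y) := by gcongr
  calc |ζ| * y * Real.exp (|ζ| * y) = |ζ| / κ * ((κ * y) * Real.exp (|ζ| * y)) := by
        field_simp
    _ ≤ |ζ| / κ * (Real.exp (κ * y) * Real.exp (κ * y)) := by gcongr
    _ = _ := by rw [← Real.exp_add]; congr 2; ring

/-- Curie–Weiss weights depend on the inverse temperature in a Lipschitz way, in the `ℓ¹` norm
normalised by `2 ^ N`, locally uniformly below criticality. -/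
lemma exists_sum_abs_cwWeight_sub_le {β : ℝ} (hβ : β < 1) :
    ∃ κ : ℝ, 0 < κ ∧ ∃ C : ℝ, 0 < C ∧ ∀ (N : ℕ) (b : ℝ), |b - β| ≤ κ →
      ∑ x : Config N, |cwWeight b N x - cwWeight β N x| ≤ C * |b - β| * 2 ^ N := by
  set m : ℝ := max β 0
  have hm : m < 1 := max_lt hβ one_pos
  have hm0 : 0 ≤ m := le_max_right _ _
  have hβm : β ≤ m := le_max_left _ _
  set κ : ℝ := (1 - m) / 4 with hκ
  have hκ0 : 0 < κ := by rw [hκ]; linarith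
  obtain ⟨C, hC, hCN⟩ := exists_sum_exp_energy_le (a := m + 2 * κ) (by linarith)
    (by rw [hκ]; linarith)
  refine ⟨κ, hκ0, C / κ, by positivity, fun N b hb => ?_⟩
  have hpt : ∀ x : Config N, |cwWeight b N x - cwWeight β N x| ≤
      |b - β| / κ * Real.exp ((m + 2 * κ) * energy x) := by
    intro x
    have hx := energy_nonneg x
    have h1 : cwWeight b N x - cwWeight β N x =
        Real.exp (β * energy x) * (Real.exp ((b - β) * energy x) - 1) := by
      rw [cwWeight_eq, cwWeight_eq, mul_sub, ← Real.exp_add, mul_one]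
      congr 2; ring
    rw [h1, abs_mul, abs_of_pos (Real.exp_pos _)]
    calc _ ≤ Real.exp (m * energy x) * (|b - β| / κ * Real.exp (2 * κ * energy x)) := by
          gcongr
          exact abs_exp_mul_sub_one_le hκ0 hb hx
      _ = _ := by rw [add_mul, Real.exp_add]; ring
  calc _ ≤ ∑ x : Config N, |b - β| / κ * Real.exp ((m + 2 * κ) * energy x) :=
        Finset.sum_le_sum fun x _ => hpt x
    _ ≤ |b - β| / κ * (C * 2 ^ N) := by
        rw [← Finset.mul_sum]
        gcongr
        exact hCN N
    _ = _ := by ring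

/-- Two independent configurations of a subcritical Curie–Weiss model have an overlap `x * y`
whose energy has small exponential moments: tilting by a factor `η` costs `O(η)`. Let `c` be the
energy of the overlap and `m` the sum of the energies of `x` and `y`. Since
`b * m + (a - b) * c ≤ a * max m c`, the two need not be controlled jointly; and for fixed `x` the
overlap is uniform when `y` is. -/
lemma exists_sum_overlap_le {b : ℝ} (hb0 : 0 ≤ b) (hb : b < 1) :
    ∃ θ : ℝ, 0 < θ ∧ ∃ C : ℝ, 0 < C ∧ ∀ (N : ℕ) (η : ℝ), 0 ≤ η → η ≤ θ →
      ∑ x : Config N, ∑ y : Config N,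
        cwWeight b N x * cwWeight b N y * (Real.exp (η * energy (x * y)) - 1) ≤
        C * η * (2 ^ N) ^ 2 := by
  set a : ℝ := (1 + b) / 2 with ha
  have hab : b < a := by rw [ha]; linarith
  obtain ⟨C, hC, hCN⟩ := exists_sum_exp_energy_le (a := a) (by linarith) (by rw [ha]; linarith)
  set θ : ℝ := (a - b) / 2 with hθ
  have hθ0 : 0 < θ := by rw [hθ]; linarith
  refine ⟨θ, hθ0, (C ^ 2 + C) / θ, by positivity, fun N η hη0 hη => ?_⟩
  have hpt : ∀ x y : Config N,
      cwWeight b N x * cwWeight b N y * (Real.exp (η * energy (x * y)) - 1) ≤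
      η / θ * (Real.exp (a * energy x) * Real.exp (a * energy y)
        + Real.exp (a * energy (x * y))) := by
    intro x y
    have hc := energy_nonneg (x * y)
    have h1 : Real.exp (η * energy (x * y)) - 1 ≤ η / θ * Real.exp (2 * θ * energy (x * y)) := by
      have := abs_exp_mul_sub_one_le hθ0 (by rwa [abs_of_nonneg hη0]) hc
      rw [abs_of_nonneg hη0] at this
      exact (le_abs_self _).trans this
    rw [cwWeight_eq, cwWeight_eq, ← Real.exp_add, ← Real.exp_add]
    calc _ ≤ Real.exp (b * energy x + b * energy y) *
            (η / θ * Real.exp (2 * θ * energy (x * y))) := by gcongr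
      _ = η / θ * Real.exp (b * energy x + b * energy y + 2 * θ * energy (x * y)) := by
          rw [Real.exp_add (_ + _)]; ring
      _ ≤ _ := by
          gcongr
          rcases le_total (energy (x * y)) (energy x + energy y) with h | h
          · refine le_add_of_le_of_nonneg (Real.exp_le_exp.2 ?_) (Real.exp_pos _).le
            rw [hθ]; nlinarith
          · refine le_add_of_nonneg_of_le (Real.exp_pos _).le (Real.exp_le_exp.2 ?_)
            rw [hθ]; nlinarith
  have hshift : ∀ x : Config N, ∑ y : Config N, Real.exp (a * energy (x * y)) =
      ∑ y : Config N, Real.exp (a * energy y) := fun x =>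
    Fintype.sum_equiv (Equiv.mulLeft x) _ _ fun y => rfl
  have hS0 : 0 ≤ ∑ x : Config N, Real.exp (a * energy x) :=
    Finset.sum_nonneg fun _ _ => (Real.exp_pos _).le
  calc _ ≤ ∑ x : Config N, ∑ y : Config N, η / θ * (Real.exp (a * energy x) *
          Real.exp (a * energy y) + Real.exp (a * energy (x * y))) :=
        Finset.sum_le_sum fun x _ => Finset.sum_le_sum fun y _ => hpt x y
    _ = η / θ * ((∑ x : Config N, Real.exp (a * energy x)) ^ 2 +
          2 ^ N * ∑ x : Config N, Real.exp (a * energy x)) := by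
        simp_rw [← Finset.mul_sum, Finset.sum_add_distrib, hshift]
        rw [← card_config, Finset.sum_mul, sq, Finset.sum_mul_sum]
        simp_rw [one_mul]
    _ ≤ η / θ * ((C * 2 ^ N) ^ 2 + 2 ^ N * (C * 2 ^ N)) := by
        gcongr <;> exact hCN N
    _ = _ := by ring

/-! ### Reduced weights -/

/-- The coefficient `tanh (β / (2 * N * p N))` in the factorisation
`exp (γ * ε * s) = cosh γ ^ ε * (1 + ε * tanh γ * s)`, valid for `ε ∈ {0, 1}` and `s ∈ {-1, 1}`. -/
noncomputable def tilt (β : ℝ) (p : ℕ → unitInterval) (N : ℕ) : ℝ :=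
  Real.tanh (β / (2 * (N : ℝ) * (p N : ℝ)))

/-- The mean of `ε * tilt β p N` for an edge indicator `ε`. -/
noncomputable def meanTilt (β : ℝ) (p : ℕ → unitInterval) (N : ℕ) : ℝ := (p N : ℝ) * tilt β p N

/-- The Bovier–Gayrard weight without the spin-independent factors `cosh γ ^ ε`, and normalised so
that its expectation is a Curie–Weiss weight. -/
noncomputable def reducedWeight (β : ℝ) (p : ℕ → unitInterval) (N : ℕ) (ω : Graphs)
    (x : Config N) : ℝ :=
  ∏ i, ∏ j, (1 + edge ω N i j * (tilt β p N * bond x i j)) / √(1 - meanTilt β p N ^ 2)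

/-- The inverse temperature of the Curie–Weiss model that the averaged reduced weights define. -/
noncomputable def effectiveBeta (β : ℝ) (p : ℕ → unitInterval) (N : ℕ) : ℝ :=
  2 * (N : ℝ) * Real.artanh (meanTilt β p N)

lemma abs_tilt_lt_one (β : ℝ) (p : ℕ → unitInterval) (N : ℕ) : |tilt β p N| < 1 :=
  Real.abs_tanh_lt_one _

lemma abs_meanTilt_lt_one (β : ℝ) (p : ℕ → unitInterval) (N : ℕ) : |meanTilt β p N| < 1 := by
  rw [meanTilt, abs_mul, abs_of_nonneg (p N).2.1]
  exact (mul_le_of_le_one_left (abs_nonneg _) (p N).2.2).trans_lt (abs_tilt_lt_one β p N)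

lemma one_sub_meanTilt_sq_pos (β : ℝ) (p : ℕ → unitInterval) (N : ℕ) :
    0 < 1 - meanTilt β p N ^ 2 := by
  have := (sq_lt_one_iff_abs_lt_one _).2 (abs_meanTilt_lt_one β p N)
  linarith

lemma edge_eq_zero_or_one (ω : Graphs) (N : ℕ) (i j : Fin N) :
    edge ω N i j = 0 ∨ edge ω N i j = 1 := by
  unfold edge; split_ifs <;> simp

lemma reducedWeight_pos (β : ℝ) (p : ℕ → unitInterval) (N : ℕ) (ω : Graphs) (x : Config N) :
    0 < reducedWeight β p N ω x := by
  refine Finset.prod_pos fun i _ => Finset.prod_pos fun j _ => ?_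
  refine div_pos ?_ (Real.sqrt_pos.2 (one_sub_meanTilt_sq_pos β p N))
  have h := abs_lt.1 (abs_tilt_lt_one β p N)
  rcases edge_eq_zero_or_one ω N i j with h1 | h1 <;> rcases bond_eq_one_or x i j with h2 | h2 <;>
    rw [h1, h2] <;> linarith [h.1, h.2]

/-- The constant `K` is random, but the same for all configurations. -/
lemma exists_bgWeight_eq_mul (β : ℝ) (p : ℕ → unitInterval) (N : ℕ) (ω : Graphs) :
    ∃ K : ℝ, 0 < K ∧ ∀ x : Config N, bgWeight β p N ω x = K * reducedWeight β p N ω x := by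
  set γ : ℝ := β / (2 * (N : ℝ) * (p N : ℝ)) with hγ
  have hr := Real.sqrt_pos.2 (one_sub_meanTilt_sq_pos β p N)
  refine ⟨∏ i : Fin N, ∏ j : Fin N,
    (1 + edge ω N i j * (Real.cosh γ - 1)) * √(1 - meanTilt β p N ^ 2), ?_, fun x => ?_⟩
  · refine Finset.prod_pos fun i _ => Finset.prod_pos fun j _ => mul_pos ?_ hr
    rcases edge_eq_zero_or_one ω N i j with h1 | h1 <;> rw [h1] <;>
      linarith [Real.cosh_pos γ]
  · rw [bgWeight, reducedWeight, ← hγ, Finset.mul_sum, Real.exp_sum, ← Finset.prod_mul_distrib]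
    refine Finset.prod_congr rfl fun i _ => ?_
    rw [Finset.mul_sum, Real.exp_sum, ← Finset.prod_mul_distrib]
    refine Finset.prod_congr rfl fun j _ => ?_
    rw [mul_assoc, mul_div_cancel₀ _ hr.ne', tilt, ← hγ, Real.tanh_eq_sinh_div_cosh]
    have hc := (Real.cosh_pos γ).ne'
    rcases edge_eq_zero_or_one ω N i j with h1 | h1 <;> rcases bond_eq_one_or x i j with h2 | h2 <;>
      rw [h1, h2] <;> field_simp <;>
      simp [Real.cosh_add_sinh, Real.cosh_sub_sinh, ← sub_eq_add_neg, mul_comm]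

lemma bgExp_eq (β : ℝ) (p : ℕ → unitInterval) (N : ℕ) (ω : Graphs) (g : Config N → ℝ) :
    bgExp β p N ω g =
      (∑ x, g x * reducedWeight β p N ω x) / ∑ x, reducedWeight β p N ω x := by
  obtain ⟨K, hK, h⟩ := exists_bgWeight_eq_mul β p N ω
  simp only [bgExp, bgProb, bgPartition, h, ← Finset.mul_sum]
  simp_rw [mul_div_mul_left _ _ hK.ne', ← mul_div_assoc]
  rw [Finset.sum_div]

/-! ### Moments of the reduced weights -/

/-- A function of the finitely many edges of one graph is integrable. -/
lemma integrable_of_edge_congr (p : ℕ → unitInterval) (N : ℕ) {F : Graphs → ℝ}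
    (hF : ∀ ω ω', (∀ i j, edge ω N i j = edge ω' N i j) → F ω = F ω') :
    Integrable F (graphMeasure p) := by
  let R : Graphs → Fin N × Fin N → Bool := fun ω e => ω (N, (e.1 : ℕ), (e.2 : ℕ))
  have hR : Measurable R := by fun_prop
  let S : (Fin N × Fin N → Bool) → Graphs := fun ε e =>
    if h : e.2.1 < N ∧ e.2.2 < N then ε (⟨e.2.1, h.1⟩, ⟨e.2.2, h.2⟩) else false
  have hFR : F = (F ∘ S) ∘ R := by
    funext ω
    refine hF _ _ fun i j => ?_
    simp [edge, S, R]
  have : IsProbabilityMeasure ((graphMeasure p).map R) :=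
    Measure.isProbabilityMeasure_map hR.aemeasurable
  rw [hFR]
  exact (Integrable.of_finite (f := F ∘ S) (μ := (graphMeasure p).map R)).comp_measurable hR

lemma integral_prod_edge (p : ℕ → unitInterval) (N : ℕ) (F : Fin N → Fin N → ℝ → ℝ) :
    ∫ ω, ∏ i, ∏ j, F i j (edge ω N i j) ∂graphMeasure p =
      ∏ i, ∏ j, ((p N : ℝ) * F i j 1 + (1 - (p N : ℝ)) * F i j 0) := by
  let κ : Fin N × Fin N → ℕ × ℕ × ℕ := fun e => (N, (e.1 : ℕ), (e.2 : ℕ))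
  have hκ : Function.Injective κ := by
    rintro ⟨i, j⟩ ⟨i', j'⟩ h
    simpa [κ, Fin.ext_iff] using h
  let G : Fin N × Fin N → Bool → ℝ := fun e b => F e.1 e.2 (if b = true then 1 else 0)
  have hmap := Measure.map_infinitePi_infinitePi_of_inj
    (P := fun e : ℕ × ℕ × ℕ => bernoulliMeasure true false (p e.1)) hκ
  rw [Measure.infinitePi_eq_pi (μ := fun e => bernoulliMeasure true false (p (κ e).1))] at hmap
  have h1 : ∀ ω : Graphs, ∏ i, ∏ j, F i j (edge ω N i j) =
      (fun ε : Fin N × Fin N → Bool => ∏ e, G e (ε e)) (fun e => ω (κ e)) := by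
    intro ω
    simp only [Fintype.prod_prod_type]
    rfl
  simp_rw [h1]
  rw [← integral_map (μ := graphMeasure p) (φ := fun ω e => ω (κ e))
    (f := fun ε : Fin N × Fin N → Bool => ∏ e, G e (ε e))
    (Measurable.aemeasurable (by fun_prop)) (measurable_of_finite _).aestronglyMeasurable]
  rw [graphMeasure, hmap, integral_fintype_prod_eq_prod, Fintype.prod_prod_type]
  refine Finset.prod_congr rfl fun i _ => Finset.prod_congr rfl fun j _ => ?_
  rw [integral_bernoulliMeasure]
  simp [G, κ]

lemma one_add_mul_div_sqrt_eq_exp {u s : ℝ} (hu : |u| < 1) (hs : s = 1 ∨ s = -1) :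
    (1 + u * s) / √(1 - u ^ 2) = Real.exp (Real.artanh u * s) := by
  have hu' : u ∈ Set.Ioo (-1 : ℝ) 1 := abs_lt.1 hu
  rcases hs with rfl | rfl
  · rw [mul_one, mul_one, ← Real.cosh_add_sinh, Real.cosh_artanh hu', Real.sinh_artanh hu']
    ring
  · rw [mul_neg_one, mul_neg_one, ← Real.cosh_sub_sinh, Real.cosh_artanh hu', Real.sinh_artanh hu']
    ring

lemma cwWeight_eq_prod (a : ℝ) (N : ℕ) (x : Config N) :
    cwWeight (2 * (N : ℝ) * a) N x = ∏ i, ∏ j, Real.exp (a * bond x i j) := by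
  rcases Nat.eq_zero_or_pos N with rfl | hN
  · simp [cwWeight]
  have : (N : ℝ) ≠ 0 := by positivity
  simp_rw [← Real.exp_sum, ← Finset.mul_sum, cwWeight]
  congr 1
  field_simp

lemma integral_reducedWeight (β : ℝ) (p : ℕ → unitInterval) (N : ℕ) (x : Config N) :
    ∫ ω, reducedWeight β p N ω x ∂graphMeasure p = cwWeight (effectiveBeta β p N) N x := by
  unfold reducedWeight
  rw [integral_prod_edge p N fun i j ε =>
    (1 + ε * (tilt β p N * bond x i j)) / √(1 - meanTilt β p N ^ 2), effectiveBeta,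
    cwWeight_eq_prod]
  refine Finset.prod_congr rfl fun i _ => Finset.prod_congr rfl fun j _ => ?_
  rw [← one_add_mul_div_sqrt_eq_exp (abs_meanTilt_lt_one β p N) (bond_eq_one_or x i j)]
  simp only [meanTilt]
  ring

/-- The contribution of one bond to the two-point function. It equals
`(1 + p t s) * (1 + p t s') + q * (s * s')` with `q = p * (1 - p) * t ^ 2`; dividing the second term
by the first product changes it by a factor `1 + O(|p t|)`, and `1 + z ≤ exp z`. -/
lemma pair_factor_le {p t s s' : ℝ} (hp0 : 0 ≤ p) (hp1 : p ≤ 1) (hu : |p * t| ≤ 1 / 4)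
    (hs : s = 1 ∨ s = -1) (hs' : s' = 1 ∨ s' = -1) :
    1 + p * t * (s + s') + p * t ^ 2 * (s * s') ≤ (1 + p * t * s) * (1 + p * t * s') *
      Real.exp (p * (1 - p) * t ^ 2 * (s * s') + 4 * (p * (1 - p) * t ^ 2) * |p * t|) := by
  set u := p * t with hu_def
  set q := p * (1 - p) * t ^ 2 with hq
  have hq0 : 0 ≤ q := by
    have : 0 ≤ 1 - p := by linarith
    positivity
  have hL : 1 + u * (s + s') + p * t ^ 2 * (s * s') = (1 + u * s) * (1 + u * s') + q * (s * s') := by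
    rw [hq, hu_def]; ring
  obtain ⟨h1, h2⟩ := abs_le.1 hu
  have hm : 0 ≤ (1 + u * s) * (1 + u * s') := by
    rcases hs with rfl | rfl <;> rcases hs' with rfl | rfl <;> nlinarith
  have hkey : s * s' * (1 - (1 + u * s) * (1 + u * s')) ≤
      4 * ((1 + u * s) * (1 + u * s')) * |u| := by
    rcases abs_cases u with ⟨h, h'⟩ | ⟨h, h'⟩ <;> rw [h] <;>
      rcases hs with rfl | rfl <;> rcases hs' with rfl | rfl <;>
      nlinarith [sq_nonneg u, mul_nonneg (abs_nonneg u) (sq_nonneg u)]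
  rw [hL]
  have := mul_le_mul_of_nonneg_left hkey hq0
  calc _ ≤ (1 + u * s) * (1 + u * s') * (q * (s * s') + 4 * q * |u| + 1) := by nlinarith
    _ ≤ _ := by gcongr; exact Real.add_one_le_exp _

/-- The two-point function of the reduced weights. The leading correlation per bond is
`p * (1 - p) * t ^ 2` times the bond of the overlap `x * y`, so that correlations are governed by
the energy of the overlap. -/
lemma integral_reducedWeight_mul_le (β : ℝ) (p : ℕ → unitInterval) (N : ℕ) (x y : Config N)
    (hu : |meanTilt β p N| ≤ 1 / 4) :
    ∫ ω, reducedWeight β p N ω x * reducedWeight β p N ω y ∂graphMeasure p ≤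
      cwWeight (effectiveBeta β p N) N x * cwWeight (effectiveBeta β p N) N y *
      Real.exp ((p N : ℝ) * (1 - p N) * tilt β p N ^ 2 * totalSpin (x * y) ^ 2 +
        (N : ℝ) ^ 2 * (4 * ((p N : ℝ) * (1 - p N) * tilt β p N ^ 2) * |meanTilt β p N|)) := by
  set t := tilt β p N
  set u := meanTilt β p N with hu_def
  set q : ℝ := (p N : ℝ) * (1 - p N) * t ^ 2 with hq
  have hr := Real.sqrt_pos.2 (one_sub_meanTilt_sq_pos β p N)
  rw [← hu_def] at hr
  have hu1 : |u| < 1 := abs_meanTilt_lt_one β p N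
  have hexp : Real.exp (q * totalSpin (x * y) ^ 2 + (N : ℝ) ^ 2 * (4 * q * |u|)) =
      ∏ i, ∏ j, Real.exp (q * (bond x i j * bond y i j) + 4 * q * |u|) := by
    simp_rw [← Real.exp_sum, Finset.sum_add_distrib, ← Finset.mul_sum, bond_mul_bond, sum_bond]
    simp
    ring
  unfold reducedWeight
  simp_rw [← Finset.prod_mul_distrib]
  rw [integral_prod_edge p N fun i j ε => (1 + ε * (t * bond x i j)) / √(1 - u ^ 2) *
    ((1 + ε * (t * bond y i j)) / √(1 - u ^ 2)), hexp, effectiveBeta,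
    cwWeight_eq_prod, cwWeight_eq_prod]
  simp_rw [← Finset.prod_mul_distrib]
  have hp0 := (p N).2.1
  have hp1 := (p N).2.2
  have ht := abs_lt.1 (abs_tilt_lt_one β p N)
  have hnn : ∀ (z : Config N) (i j : Fin N), 0 ≤ 1 + t * bond z i j := by
    intro z i j
    rcases bond_eq_one_or z i j with h | h <;> rw [h] <;> linarith [ht.1, ht.2]
  have h0 : ∀ i j : Fin N, 0 ≤ (p N : ℝ) * ((1 + 1 * (t * bond x i j)) / √(1 - u ^ 2) *
      ((1 + 1 * (t * bond y i j)) / √(1 - u ^ 2))) + (1 - (p N : ℝ)) *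
      ((1 + 0 * (t * bond x i j)) / √(1 - u ^ 2) * ((1 + 0 * (t * bond y i j)) / √(1 - u ^ 2))) := by
    intro i j
    have h1 := hnn x i j
    have h2 := hnn y i j
    have h3 : 0 ≤ 1 - (p N : ℝ) := by linarith
    simp only [one_mul, zero_mul, add_zero]
    positivity
  refine Finset.prod_le_prod (fun i _ => Finset.prod_nonneg fun j _ => h0 i j) fun i _ =>
    Finset.prod_le_prod (fun j _ => h0 i j) fun j _ => ?_
  have hb := bond_eq_one_or x i j
  have hb' := bond_eq_one_or y i j
  rw [← one_add_mul_div_sqrt_eq_exp hu1 hb, ← one_add_mul_div_sqrt_eq_exp hu1 hb']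
  have hpair := pair_factor_le hp0 hp1 hu hb hb'
  calc _ = (1 + u * (bond x i j + bond y i j) + (p N : ℝ) * t ^ 2 * (bond x i j * bond y i j)) /
          √(1 - u ^ 2) ^ 2 := by
        rw [hu_def, meanTilt]; field_simp; ring
    _ ≤ (1 + u * bond x i j) * (1 + u * bond y i j) *
          Real.exp (q * (bond x i j * bond y i j) + 4 * q * |u|) / √(1 - u ^ 2) ^ 2 := by
        gcongr
        exact hpair
    _ = _ := by field_simp

/-! ### Asymptotics of the parameters -/

lemma abs_tanh_sub_self_le {x : ℝ} (hx : |x| ≤ 1) : |Real.tanh x - x| ≤ 2 * x ^ 2 := by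
  have h1 := abs_le.1 (Real.abs_exp_sub_one_sub_id_le hx)
  have h2 := abs_le.1 (Real.abs_exp_sub_one_sub_id_le (x := -x) (by rwa [abs_neg]))
  have hc := Real.one_le_cosh x
  have hc0 := Real.cosh_pos x
  have hx' := abs_le.1 hx
  have hs1 : |Real.sinh x - x| ≤ x ^ 2 := by
    rw [Real.sinh_eq, abs_le]; constructor <;> nlinarith [h1.1, h1.2, h2.1, h2.2]
  have hc1 : Real.cosh x - 1 ≤ x ^ 2 := by
    rw [Real.cosh_eq]; nlinarith [h1.1, h1.2, h2.1, h2.2]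
  have hnum : |Real.sinh x - x * Real.cosh x| ≤ 2 * x ^ 2 := by
    have : Real.sinh x - x * Real.cosh x = (Real.sinh x - x) - x * (Real.cosh x - 1) := by ring
    rw [this]
    refine (abs_sub _ _).trans ?_
    rw [abs_mul, abs_of_nonneg (sub_nonneg.2 hc)]
    nlinarith [abs_nonneg x]
  rw [Real.tanh_eq_sinh_div_cosh, div_sub' hc0.ne', abs_div, abs_of_pos hc0, div_le_iff₀ hc0]
  rw [mul_comm (Real.cosh x)]
  nlinarith [sq_nonneg x]

lemma abs_artanh_sub_self_le {u : ℝ} (hu : |u| ≤ 1 / 4) : |Real.artanh u - u| ≤ 2 * u ^ 2 := by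
  obtain ⟨h1, h2⟩ := abs_le.1 hu
  have hp : 0 < 1 + u := by linarith
  have hm : 0 < 1 - u := by linarith
  rw [Real.artanh_eq_half_log ⟨by linarith, by linarith⟩, Real.log_div hp.ne' hm.ne']
  have a1 := Real.log_le_sub_one_of_pos hp
  have a2 := Real.log_le_sub_one_of_pos hm
  have a3 := Real.one_sub_inv_le_log_of_pos hp
  have a4 := Real.one_sub_inv_le_log_of_pos hm
  have b3 : u - 2 * u ^ 2 ≤ 1 - (1 + u)⁻¹ := by
    rw [inv_eq_one_div, le_sub_comm, div_le_iff₀ hp]; nlinarith [sq_nonneg u]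
  have b4 : -u - 2 * u ^ 2 ≤ 1 - (1 - u)⁻¹ := by
    rw [inv_eq_one_div, le_sub_comm, div_le_iff₀ hm]; nlinarith [sq_nonneg u]
  rw [abs_le]; constructor <;> nlinarith [sq_nonneg u]

/-- Asymptotics of the parameters of the reduced weights, in terms of `1 / (N * p N)`. -/
lemma parameter_bounds {β : ℝ} {p : ℕ → unitInterval} {N : ℕ} {r : ℝ} (hr0 : 0 < r)
    (hr : (N : ℝ) * (p N : ℝ) * r = 1) (hβr : |β| * r ≤ 1 / 4) :
    |meanTilt β p N| ≤ 1 / 4 ∧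
    |effectiveBeta β p N - β| ≤ 5 * β ^ 2 * r ∧
    2 * (N : ℝ) * ((p N : ℝ) * (1 - p N) * tilt β p N ^ 2) ≤ 2 * β ^ 2 * r ∧
    (N : ℝ) ^ 2 * (4 * ((p N : ℝ) * (1 - p N) * tilt β p N ^ 2) * |meanTilt β p N|) ≤
      4 * |β| ^ 3 * r := by
  have hp0 : (0 : ℝ) ≤ p N := (p N).2.1
  have hp1 : (p N : ℝ) ≤ 1 := (p N).2.2
  have hN0 : (0 : ℝ) ≤ N := N.cast_nonneg
  set P : ℝ := (p N : ℝ)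
  set n : ℝ := (N : ℝ)
  have hnP : 0 < n * P := by
    by_contra h
    have : n * P = 0 := le_antisymm (not_lt.1 h) (by positivity)
    rw [this] at hr; simp at hr
  have hγ : β / (2 * n * P) = β * r / 2 := by
    rw [mul_assoc, div_eq_div_iff (by positivity) two_ne_zero]
    linear_combination (-2 * β) * hr
  set γ : ℝ := β * r / 2 with hγ_def
  have habsγ : |γ| = |β| * r / 2 := by
    rw [hγ_def, abs_div, abs_mul, abs_of_pos hr0, abs_two]
  have hγ8 : |γ| ≤ 1 / 8 := by rw [habsγ]; linarith
  have ht := abs_tanh_sub_self_le (x := γ) (by linarith)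
  have htilt : tilt β p N = Real.tanh γ := by rw [tilt, ← hγ]
  set t := tilt β p N
  rw [← htilt] at ht
  have htγ : |t| ≤ 2 * |γ| := by
    have h1 : |t| ≤ |t - γ| + |γ| := by simpa using abs_add_le (t - γ) γ
    nlinarith [abs_nonneg γ, sq_abs γ]
  have ht2 : t ^ 2 ≤ 4 * γ ^ 2 := by
    rw [← sq_abs t, ← sq_abs γ]; nlinarith [abs_nonneg t, abs_nonneg γ]
  have hu : meanTilt β p N = P * t := rfl
  set u := meanTilt β p N
  have habsu : |u| ≤ P * (2 * |γ|) := by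
    rw [hu, abs_mul, abs_of_nonneg hp0]; gcongr
  have hu4 : |u| ≤ 1 / 4 := by nlinarith [abs_nonneg γ]
  have hq : P * (1 - P) * t ^ 2 ≤ P * (4 * γ ^ 2) := by
    have : P * (1 - P) ≤ P := by nlinarith
    calc _ ≤ P * t ^ 2 := by gcongr
      _ ≤ _ := by gcongr
  refine ⟨hu4, ?_, ?_, ?_⟩
  · have ha := abs_artanh_sub_self_le hu4
    have hβ : β = 2 * n * (P * γ) := by rw [hγ_def]; linear_combination (-β) * hr
    have hu2 : u ^ 2 ≤ 4 * (P * γ ^ 2) := by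
      rw [hu, mul_pow]
      calc P ^ 2 * t ^ 2 ≤ P * (4 * γ ^ 2) := by gcongr; nlinarith
        _ = _ := by ring
    have h1 : |Real.artanh u - P * γ| ≤ 10 * (P * γ ^ 2) := by
      have h2 : |u - P * γ| ≤ P * (2 * γ ^ 2) := by
        rw [hu, ← mul_sub, abs_mul, abs_of_nonneg hp0]; gcongr
      have h3 := abs_sub_le (Real.artanh u) u (P * γ)
      linarith
    calc |effectiveBeta β p N - β| = 2 * n * |Real.artanh u - P * γ| := by
          rw [show effectiveBeta β p N = 2 * n * Real.artanh u from rfl]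
          nth_rewrite 1 [hβ]
          rw [← mul_sub, abs_mul, abs_of_nonneg (by positivity)]
      _ ≤ 2 * n * (10 * (P * γ ^ 2)) := by gcongr
      _ = 5 * β ^ 2 * r := by rw [hγ_def]; linear_combination (5 * β ^ 2 * r) * hr
  · calc _ ≤ 2 * n * (P * (4 * γ ^ 2)) := by gcongr
      _ = 2 * β ^ 2 * r := by rw [hγ_def]; linear_combination (2 * β ^ 2 * r) * hr
  · calc _ ≤ n ^ 2 * (4 * (P * (4 * γ ^ 2)) * (P * (2 * |γ|))) := by gcongr
      _ = 4 * |β| ^ 3 * r := by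
        rw [habsγ, hγ_def, ← sq_abs (β * r / 2), abs_div, abs_mul, abs_of_pos hr0, abs_two]
        linear_combination (4 * |β| ^ 3 * r * (n * P * r + 1)) * hr

/-! ### Mean-square concentration of partition sums -/

lemma integrable_reducedWeight_comp (β : ℝ) (p : ℕ → unitInterval) (N : ℕ)
    (F : (Config N → ℝ) → ℝ) :
    Integrable (fun ω => F (reducedWeight β p N ω)) (graphMeasure p) := by
  refine integrable_of_edge_congr p N fun ω ω' h => ?_
  have : reducedWeight β p N ω = reducedWeight β p N ω' := by
    funext x; simp only [reducedWeight, h]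
  simp only [this]

/-- Second moment of the deviation of reduced partition sums from Curie–Weiss partition sums: a
bias term from the shift of the inverse temperature and a variance term from the correlations. -/
lemma integral_sq_sum_reducedWeight_sub (β : ℝ) (p : ℕ → unitInterval) (N : ℕ)
    (g : Config N → ℝ) :
    ∫ ω, (∑ x, g x * (reducedWeight β p N ω x - cwWeight β N x)) ^ 2 ∂graphMeasure p =
      (∑ x, g x * (cwWeight (effectiveBeta β p N) N x - cwWeight β N x)) ^ 2 +
      ∑ x, ∑ y, g x * g y *
        (∫ ω, reducedWeight β p N ω x * reducedWeight β p N ω y ∂graphMeasure p -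
          cwWeight (effectiveBeta β p N) N x * cwWeight (effectiveBeta β p N) N y) := by
  have hpair : ∀ x y : Config N,
      ∫ ω, (reducedWeight β p N ω x - cwWeight β N x) *
        (reducedWeight β p N ω y - cwWeight β N y) ∂graphMeasure p =
      ∫ ω, reducedWeight β p N ω x * reducedWeight β p N ω y ∂graphMeasure p -
        cwWeight (effectiveBeta β p N) N x * cwWeight (effectiveBeta β p N) N y +
      (cwWeight (effectiveBeta β p N) N x - cwWeight β N x) *
        (cwWeight (effectiveBeta β p N) N y - cwWeight β N y) := by
    intro x y
    have e : ∀ ω, (reducedWeight β p N ω x - cwWeight β N x) *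
        (reducedWeight β p N ω y - cwWeight β N y) =
        reducedWeight β p N ω x * reducedWeight β p N ω y
          - cwWeight β N y * reducedWeight β p N ω x
          - cwWeight β N x * reducedWeight β p N ω y
          + cwWeight β N x * cwWeight β N y := fun ω => by ring
    simp_rw [e]
    have i1 := integrable_reducedWeight_comp β p N fun W => W x * W y
    have i2 := integrable_reducedWeight_comp β p N fun W => cwWeight β N y * W x
    have i3 := integrable_reducedWeight_comp β p N fun W => cwWeight β N x * W y
    rw [integral_add (by exact (i1.sub i2).sub i3) (integrable_const _),
      integral_sub (by exact i1.sub i2) i3, integral_sub i1 i2, integral_const_mul,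
      integral_const_mul, integral_reducedWeight,
      integral_reducedWeight]
    simp
    ring
  have hexpand : ∀ W : Config N → ℝ, (∑ x, g x * W x) ^ 2 =
      ∑ x, ∑ y, g x * g y * (W x * W y) := by
    intro W
    rw [sq, Finset.sum_mul_sum]
    exact Finset.sum_congr rfl fun x _ => Finset.sum_congr rfl fun y _ => by ring
  simp_rw [hexpand fun x => reducedWeight β p N _ x - cwWeight β N x]
  rw [hexpand fun x => cwWeight (effectiveBeta β p N) N x - cwWeight β N x,
    integral_finsetSum _ fun x _ => integrable_reducedWeight_comp β p N fun W =>
      ∑ y, g x * g y * ((W x - cwWeight β N x) * (W y - cwWeight β N y)),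
    ← Finset.sum_add_distrib]
  refine Finset.sum_congr rfl fun x _ => ?_
  rw [integral_finsetSum _ fun y _ => integrable_reducedWeight_comp β p N fun W =>
      g x * g y * ((W x - cwWeight β N x) * (W y - cwWeight β N y)),
    ← Finset.sum_add_distrib]
  refine Finset.sum_congr rfl fun y _ => ?_
  rw [integral_const_mul, hpair]
  ring

lemma cwWeight_pos (β : ℝ) (N : ℕ) (x : Config N) : 0 < cwWeight β N x := Real.exp_pos _

lemma cwWeight_mono {b' b : ℝ} (h : b' ≤ b) (N : ℕ) (x : Config N) :
    cwWeight b' N x ≤ cwWeight b N x := by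
  rw [cwWeight_eq, cwWeight_eq]
  have := energy_nonneg x
  gcongr

/-- Bound on the variance of `∑ x, g x * W x` for random weights `W` whose two-point function is
`R`. Nonnegativity of `g` makes a one-sided bound on the correlations sufficient. -/
lemma sum_correlation_le {N : ℕ} {b b' η δ B : ℝ} {g : Config N → ℝ}
    {R : Config N → Config N → ℝ} (hb' : b' ≤ b) (hη0 : 0 ≤ η) (hδ0 : 0 ≤ δ) (hδ1 : δ ≤ 1)
    (hg0 : ∀ x, 0 ≤ g x) (hgB : ∀ x, g x ≤ B)
    (hR : ∀ x y, R x y ≤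
      cwWeight b' N x * cwWeight b' N y * Real.exp (η * energy (x * y) + δ)) :
    ∑ x, ∑ y, g x * g y * (R x y - cwWeight b' N x * cwWeight b' N y) ≤
      B ^ 2 * (3 * (∑ x : Config N, ∑ y : Config N, cwWeight b N x * cwWeight b N y *
        (Real.exp (η * energy (x * y)) - 1)) + 3 * δ * (∑ x : Config N, cwWeight b N x) ^ 2) := by
  have hB0 : 0 ≤ B := (hg0 1).trans (hgB 1)
  -- `exp δ ≤ 3` because `δ ≤ 1`, and hence `exp δ - 1 ≤ 3 * δ`
  have hexpδ : Real.exp δ ≤ 3 := (Real.exp_le_exp.2 hδ1).trans Real.exp_one_lt_three.le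
  have hexpδ1 : Real.exp δ - 1 ≤ 3 * δ := by
    have := abs_exp_sub_one_le_mul_exp_abs δ
    rw [abs_of_nonneg hδ0] at this
    nlinarith [le_abs_self (Real.exp δ - 1)]
  have hvar : ∀ x y : Config N, g x * g y * (R x y - cwWeight b' N x * cwWeight b' N y) ≤
      B ^ 2 * (3 * (cwWeight b N x * cwWeight b N y * (Real.exp (η * energy (x * y)) - 1)) +
        3 * δ * (cwWeight b N x * cwWeight b N y)) := by
    intro x y
    set E := Real.exp (η * energy (x * y)) with hE
    have he1 : 1 ≤ E := Real.one_le_exp (mul_nonneg hη0 (energy_nonneg _))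
    have h3 : E * Real.exp δ - 1 ≤ 3 * (E - 1) + 3 * δ := by nlinarith
    have h4 : 0 ≤ 3 * (E - 1) + 3 * δ := by linarith
    have hR' := hR x y
    rw [Real.exp_add, ← hE] at hR'
    have hww : cwWeight b' N x * cwWeight b' N y ≤ cwWeight b N x * cwWeight b N y :=
      mul_le_mul (cwWeight_mono hb' N x) (cwWeight_mono hb' N y) (cwWeight_pos _ _ _).le
        (cwWeight_pos _ _ _).le
    have hw0 : 0 ≤ cwWeight b' N x * cwWeight b' N y :=
      (mul_pos (cwWeight_pos _ _ _) (cwWeight_pos _ _ _)).le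
    have hgg : g x * g y ≤ B * B := mul_le_mul (hgB x) (hgB y) (hg0 y) hB0
    have hgg0 : 0 ≤ g x * g y := mul_nonneg (hg0 x) (hg0 y)
    calc _ ≤ g x * g y * (cwWeight b' N x * cwWeight b' N y * (E * Real.exp δ - 1)) := by
          refine mul_le_mul_of_nonneg_left ?_ hgg0
          linarith
      _ ≤ g x * g y * (cwWeight b' N x * cwWeight b' N y * (3 * (E - 1) + 3 * δ)) :=
          mul_le_mul_of_nonneg_left (mul_le_mul_of_nonneg_left h3 hw0) hgg0
      _ ≤ B * B * (cwWeight b N x * cwWeight b N y * (3 * (E - 1) + 3 * δ)) :=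
          mul_le_mul hgg (mul_le_mul_of_nonneg_right hww h4) (mul_nonneg hw0 h4)
            (mul_nonneg hB0 hB0)
      _ = _ := by ring
  calc _ ≤ ∑ x : Config N, ∑ y : Config N, B ^ 2 * (3 * (cwWeight b N x * cwWeight b N y *
            (Real.exp (η * energy (x * y)) - 1)) + 3 * δ * (cwWeight b N x * cwWeight b N y)) :=
          Finset.sum_le_sum fun x _ => Finset.sum_le_sum fun y _ => hvar x y
    _ = B ^ 2 * (3 * (∑ x : Config N, ∑ y : Config N, cwWeight b N x * cwWeight b N y *
            (Real.exp (η * energy (x * y)) - 1)) +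
            3 * δ * (∑ x : Config N, cwWeight b N x) ^ 2) := by
          rw [sq (∑ x : Config N, cwWeight b N x), Finset.sum_mul_sum]
          simp_rw [← Finset.mul_sum, Finset.sum_add_distrib, ← Finset.mul_sum]

/-- Reduced partition sums are close to Curie–Weiss partition sums in mean square, relative to
`2 ^ N`. The variable `r` stands for `1 / (N * p N)`. -/
lemma exists_integral_sq_sum_le {β : ℝ} (hβ : β < 1) (p : ℕ → unitInterval) :
    ∃ K : ℝ, 0 < K ∧ ∃ r₀ : ℝ, 0 < r₀ ∧ ∀ (N : ℕ) (r : ℝ), 0 < r → r ≤ r₀ →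
      (N : ℝ) * (p N : ℝ) * r = 1 → ∀ (B : ℝ) (g : Config N → ℝ), (∀ x, 0 ≤ g x) →
      (∀ x, g x ≤ B) →
      ∫ ω, (∑ x, g x * (reducedWeight β p N ω x - cwWeight β N x)) ^ 2 ∂graphMeasure p ≤
        K * r * (B * 2 ^ N) ^ 2 := by
  obtain ⟨κ, hκ, C₁, hC₁, hbias⟩ := exists_sum_abs_cwWeight_sub_le hβ
  set m : ℝ := max β 0
  have hm : m < 1 := max_lt hβ one_pos
  have hm0 : 0 ≤ m := le_max_right _ _
  have hβm : β ≤ m := le_max_left _ _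
  set b : ℝ := (1 + m) / 2 with hb
  have hb0 : 0 ≤ b := by rw [hb]; linarith
  have hb1 : b < 1 := by rw [hb]; linarith
  have hmb : 0 < b - m := by rw [hb]; linarith
  obtain ⟨θ, hθ, C₂, hC₂, hoverlap⟩ := exists_sum_overlap_le hb0 hb1
  obtain ⟨C₃, hC₃, hpart⟩ := exists_sum_exp_energy_le hb0 hb1
  -- `D` dominates all the constants of `parameter_bounds`
  set D : ℝ := 1 + 4 * |β| + 5 * β ^ 2 + 4 * |β| ^ 3 with hD
  have hD1 : 1 ≤ D := by rw [hD]; have := abs_nonneg β; nlinarith [sq_nonneg β, pow_nonneg this 3]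
  have hD0 : 0 < D := by linarith
  have hβ0 := abs_nonneg β
  have hβ3 : 0 ≤ |β| ^ 3 := by positivity
  refine ⟨(C₁ * D) ^ 2 + 3 * D * (C₂ + C₃ ^ 2), by positivity,
    min (min κ (b - m)) (min θ 1) / D, by positivity, fun N r hr0 hr hNr B g hg0 hgB => ?_⟩
  have hDr : D * r ≤ min (min κ (b - m)) (min θ 1) := by
    rw [le_div_iff₀ hD0] at hr; linarith
  have hDκ : D * r ≤ κ := hDr.trans ((min_le_left _ _).trans (min_le_left _ _))
  have hDb : D * r ≤ b - m := hDr.trans ((min_le_left _ _).trans (min_le_right _ _))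
  have hDθ : D * r ≤ θ := hDr.trans ((min_le_right _ _).trans (min_le_left _ _))
  have hDone : D * r ≤ 1 := hDr.trans ((min_le_right _ _).trans (min_le_right _ _))
  have hrD : r ≤ D * r := le_mul_of_one_le_left hr0.le hD1
  obtain ⟨hu, hshift, hη, hδ⟩ := parameter_bounds (β := β) hr0 hNr (by
    have : 4 * |β| * r ≤ D * r := by
      gcongr; rw [hD]; linarith [sq_nonneg β]
    linarith)
  set η : ℝ := 2 * (N : ℝ) * ((p N : ℝ) * (1 - p N) * tilt β p N ^ 2) with hη_def
  set δ : ℝ := (N : ℝ) ^ 2 *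
    (4 * ((p N : ℝ) * (1 - p N) * tilt β p N ^ 2) * |meanTilt β p N|) with hδ_def
  have hp0 : (0 : ℝ) ≤ p N := (p N).2.1
  have hp1 : (0 : ℝ) ≤ 1 - p N := sub_nonneg.2 (p N).2.2
  have hη0 : 0 ≤ η := by positivity
  have hδ0 : 0 ≤ δ := by positivity
  have hshift' : |effectiveBeta β p N - β| ≤ D * r := hshift.trans (by
    gcongr; rw [hD]; linarith)
  have hη' : η ≤ D * r := hη.trans (by gcongr; rw [hD]; linarith [sq_nonneg β])
  have hδ' : δ ≤ D * r := hδ.trans (by gcongr; rw [hD]; linarith [sq_nonneg β])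
  have hB0 : 0 ≤ B := (hg0 1).trans (hgB 1)
  set b' := effectiveBeta β p N
  have hb' : b' ≤ b := by linarith [le_abs_self (b' - β)]
  rw [integral_sq_sum_reducedWeight_sub]
  have hbias' : (∑ x, g x * (cwWeight b' N x - cwWeight β N x)) ^ 2 ≤
      (C₁ * D) ^ 2 * r * (B * 2 ^ N) ^ 2 := by
    have h1 : |∑ x, g x * (cwWeight b' N x - cwWeight β N x)| ≤ B * (C₁ * (D * r) * 2 ^ N) := by
      calc _ ≤ ∑ x, |g x * (cwWeight b' N x - cwWeight β N x)| := Finset.abs_sum_le_sum_abs _ _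
        _ ≤ ∑ x, B * |cwWeight b' N x - cwWeight β N x| := by
            gcongr with x
            rw [abs_mul, abs_of_nonneg (hg0 x)]
            gcongr
            exact hgB x
        _ ≤ B * (C₁ * |b' - β| * 2 ^ N) := by
            rw [← Finset.mul_sum]; gcongr; exact hbias N b' (hshift'.trans hDκ)
        _ ≤ _ := by gcongr
    rw [← sq_abs]
    calc _ ≤ (B * (C₁ * (D * r) * 2 ^ N)) ^ 2 := by gcongr
      _ = (C₁ * D) ^ 2 * (r * r) * (B * 2 ^ N) ^ 2 := by ring
      _ ≤ (C₁ * D) ^ 2 * (r * 1) * (B * 2 ^ N) ^ 2 := by gcongr; linarith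
      _ = _ := by ring
  have hR : ∀ x y : Config N,
      ∫ ω, reducedWeight β p N ω x * reducedWeight β p N ω y ∂graphMeasure p ≤
        cwWeight b' N x * cwWeight b' N y * Real.exp (η * energy (x * y) + δ) := by
    intro x y
    have hen : (p N : ℝ) * (1 - p N) * tilt β p N ^ 2 * totalSpin (x * y) ^ 2 =
        η * energy (x * y) := by
      rw [hη_def, energy]
      rcases Nat.eq_zero_or_pos N with rfl | hN
      · simp at hNr
      · field_simp
    rw [← hen]
    exact integral_reducedWeight_mul_le β p N x y hu
  have hS0 : 0 ≤ ∑ x : Config N, cwWeight b N x :=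
    Finset.sum_nonneg fun x _ => (cwWeight_pos b N x).le
  have hS : ∑ x : Config N, cwWeight b N x ≤ C₃ * 2 ^ N := by
    simp_rw [cwWeight_eq]; exact hpart N
  have hvar := calc
    _ ≤ _ := sum_correlation_le hb' hη0 hδ0 (hδ'.trans hDone) hg0 hgB hR
    _ ≤ B ^ 2 * (3 * (C₂ * (D * r) * (2 ^ N) ^ 2) + 3 * (D * r) * (C₃ * 2 ^ N) ^ 2) := by
        gcongr
        refine (hoverlap N η hη0 (hη'.trans hDθ)).trans ?_
        gcongr
    _ = 3 * D * (C₂ + C₃ ^ 2) * r * (B * 2 ^ N) ^ 2 := by ring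
  linarith

/-! ### Comparison of quenched and Curie–Weiss expectations -/

/-- Expectations with respect to two systems of weights differ by at most the differences of the
two unnormalised sums, since the first expectation is itself bounded by `B`. -/
lemma abs_sum_div_sum_sub_le {ι : Type*} [Fintype ι] [Nonempty ι] {g W w : ι → ℝ} {B : ℝ}
    (hg0 : ∀ x, 0 ≤ g x) (hgB : ∀ x, g x ≤ B) (hW : ∀ x, 0 < W x) (hw : ∀ x, 0 < w x) :
    |(∑ x, g x * W x) / (∑ x, W x) - (∑ x, g x * w x) / ∑ x, w x| ≤
      (|∑ x, g x * (W x - w x)| + B * |∑ x, 1 * (W x - w x)|) / ∑ x, w x := by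
  have hW' : 0 < ∑ x, W x := Finset.sum_pos (fun x _ => hW x) Finset.univ_nonempty
  have hw' : 0 < ∑ x, w x := Finset.sum_pos (fun x _ => hw x) Finset.univ_nonempty
  set A := (∑ x, g x * W x) / (∑ x, W x) with hA
  have hA0 : 0 ≤ A := div_nonneg (Finset.sum_nonneg fun x _ => mul_nonneg (hg0 x) (hW x).le) hW'.le
  have hAB : A ≤ B := by
    rw [hA, div_le_iff₀ hW', Finset.mul_sum]
    exact Finset.sum_le_sum fun x _ => mul_le_mul_of_nonneg_right (hgB x) (hW x).le
  have key : A - (∑ x, g x * w x) / ∑ x, w x =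
      (∑ x, g x * (W x - w x) - A * ∑ x, 1 * (W x - w x)) / ∑ x, w x := by
    have h1 : A * ∑ x, W x = ∑ x, g x * W x := div_mul_cancel₀ _ hW'.ne'
    simp only [one_mul, mul_sub, Finset.sum_sub_distrib]
    rw [h1]
    field_simp
    ring
  rw [key, abs_div, abs_of_pos hw']
  gcongr
  refine (abs_sub _ _).trans ?_
  rw [abs_mul, abs_of_nonneg hA0]
  gcongr

lemma cwExp_eq (β : ℝ) (N : ℕ) (g : Config N → ℝ) :
    cwExp β N g = (∑ x, g x * cwWeight β N x) / ∑ x, cwWeight β N x := by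
  simp only [cwExp, cwProb, cwPartition, ← mul_div_assoc, Finset.sum_div]

/-- Quenched expectations of bounded nonnegative functions are close to Curie–Weiss expectations
in mean square, at rate `1 / (N * p N)`. -/
lemma exists_integral_sq_bgExp_sub_le {β : ℝ} (hβ : β < 1) (p : ℕ → unitInterval) :
    ∃ K : ℝ, 0 < K ∧ ∃ r₀ : ℝ, 0 < r₀ ∧ ∀ (N : ℕ) (r : ℝ), 0 < r → r ≤ r₀ →
      (N : ℝ) * (p N : ℝ) * r = 1 → ∀ (B : ℝ) (g : Config N → ℝ), (∀ x, 0 ≤ g x) →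
      (∀ x, g x ≤ B) →
      ∫ ω, (bgExp β p N ω g - cwExp β N g) ^ 2 ∂graphMeasure p ≤ K * r * B ^ 2 := by
  obtain ⟨K, hK, r₀, hr₀, h⟩ := exists_integral_sq_sum_le hβ p
  obtain ⟨c, hc, hcN⟩ := exists_le_cwPartition β
  refine ⟨4 * K / c ^ 2, by positivity, r₀, hr₀, fun N r hr0 hr hNr B g hg0 hgB => ?_⟩
  have hB0 : 0 ≤ B := (hg0 1).trans (hgB 1)
  have h1 := h N r hr0 hr hNr B g hg0 hgB
  have h2 := h N r hr0 hr hNr 1 (fun _ => 1) (fun _ => zero_le_one) fun _ => le_rfl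
  have hpt : ∀ ω, (bgExp β p N ω g - cwExp β N g) ^ 2 ≤
      2 * (c * 2 ^ N)⁻¹ ^ 2 * ((∑ x, g x * (reducedWeight β p N ω x - cwWeight β N x)) ^ 2 +
        B ^ 2 * (∑ x, 1 * (reducedWeight β p N ω x - cwWeight β N x)) ^ 2) := by
    intro ω
    have h3 := abs_sum_div_sum_sub_le hg0 hgB (reducedWeight_pos β p N ω)
      (cwWeight_pos β N)
    rw [← bgExp_eq, ← cwExp_eq] at h3
    set X := ∑ x, g x * (reducedWeight β p N ω x - cwWeight β N x)
    set Y := ∑ x, 1 * (reducedWeight β p N ω x - cwWeight β N x)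
    have h4 : |bgExp β p N ω g - cwExp β N g| ≤ (|X| + B * |Y|) / (c * 2 ^ N) :=
      h3.trans (div_le_div_of_nonneg_left (by positivity) (by positivity) (hcN N))
    rw [← sq_abs]
    calc _ ≤ ((|X| + B * |Y|) / (c * 2 ^ N)) ^ 2 := by gcongr
      _ = (c * 2 ^ N)⁻¹ ^ 2 * (|X| + B * |Y|) ^ 2 := by rw [div_eq_inv_mul, mul_pow]
      _ ≤ (c * 2 ^ N)⁻¹ ^ 2 * (2 * (|X| ^ 2 + (B * |Y|) ^ 2)) := by
          gcongr; exact add_sq_le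
      _ = _ := by rw [mul_pow, sq_abs, sq_abs]; ring
  have i0 : Integrable (fun ω => (bgExp β p N ω g - cwExp β N g) ^ 2) (graphMeasure p) := by
    simp_rw [bgExp_eq]
    exact integrable_reducedWeight_comp β p N fun W =>
      ((∑ x, g x * W x) / (∑ x, W x) - cwExp β N g) ^ 2
  have i1 := integrable_reducedWeight_comp β p N fun W =>
    (∑ x, g x * (W x - cwWeight β N x)) ^ 2
  have i2 := integrable_reducedWeight_comp β p N fun W =>
    B ^ 2 * (∑ x, 1 * (W x - cwWeight β N x)) ^ 2
  calc _ ≤ ∫ ω, 2 * (c * 2 ^ N)⁻¹ ^ 2 *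
          ((∑ x, g x * (reducedWeight β p N ω x - cwWeight β N x)) ^ 2 +
          B ^ 2 * (∑ x, 1 * (reducedWeight β p N ω x - cwWeight β N x)) ^ 2) ∂graphMeasure p :=
        integral_mono i0 ((i1.add i2).const_mul _) hpt
    _ ≤ 2 * (c * 2 ^ N)⁻¹ ^ 2 * (K * r * (B * 2 ^ N) ^ 2 +
          B ^ 2 * (K * r * (1 * 2 ^ N) ^ 2)) := by
        rw [integral_const_mul, integral_add i1 i2, integral_const_mul]
        gcongr
    _ = _ := by field_simp; ring

lemma sum_bgProb (β : ℝ) (p : ℕ → unitInterval) (N : ℕ) (ω : Graphs) :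
    ∑ x, bgProb β p N ω x = 1 := by
  have h : 0 < bgPartition β p N ω :=
    Finset.sum_pos (fun _ _ => Real.exp_pos _) Finset.univ_nonempty
  simp only [bgProb, ← Finset.sum_div]
  exact div_self h.ne'

lemma sum_cwProb (β : ℝ) (N : ℕ) : ∑ x : Config N, cwProb β N x = 1 := by
  simp only [cwProb, ← Finset.sum_div]
  exact div_self (cwPartition_pos β N).ne'

/-- Quenched expectations of uniformly bounded functions asymptotically coincide, in
probability, with Curie–Weiss expectations. No convergence of the latter is needed. -/
theorem tendstoInMeasure_bgExp_sub_cwExp {β : ℝ} (hβ : β < 1) {p : ℕ → unitInterval}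
    (hNp : Tendsto (fun N : ℕ => (N : ℝ) * (p N : ℝ)) atTop atTop)
    {f : ∀ N : ℕ, Config N → ℝ} {M : ℝ} (hf : ∀ N x, |f N x| ≤ M) :
    TendstoInMeasure (graphMeasure p) (fun N ω => bgExp β p N ω (f N) - cwExp β N (f N)) atTop
      (fun _ => 0) := by
  obtain ⟨K, hK, r₀, hr₀, h⟩ := exists_integral_sq_bgExp_sub_le hβ p
  rw [tendstoInMeasure_iff_measureReal_dist]
  intro ε hε
  have hr : Tendsto (fun N : ℕ => ((N : ℝ) * (p N : ℝ))⁻¹) atTop (𝓝 0) := hNp.inv_tendsto_atTop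
  have hlim : Tendsto (fun N : ℕ => K * ((N : ℝ) * (p N : ℝ))⁻¹ * (2 * M) ^ 2 / ε ^ 2) atTop
      (𝓝 0) := by
    simpa using ((hr.const_mul K).mul_const ((2 * M) ^ 2)).div_const (ε ^ 2)
  refine squeeze_zero' (Eventually.of_forall fun _ => measureReal_nonneg) ?_ hlim
  filter_upwards [hNp.eventually_gt_atTop 0, hr.eventually_le_const hr₀] with N hN hNr
  -- adding the constant `M` makes the function nonnegative and shifts both expectations by `M`
  have hshift : ∀ ω, bgExp β p N ω (f N) - cwExp β N (f N) =
      bgExp β p N ω (fun x => f N x + M) - cwExp β N (fun x => f N x + M) := by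
    intro ω
    simp only [bgExp, cwExp, add_mul, Finset.sum_add_distrib, ← Finset.mul_sum, sum_bgProb,
      sum_cwProb]
    ring
  have h1 := h N _ (inv_pos.2 hN) hNr (mul_inv_cancel₀ hN.ne') (2 * M) (fun x => f N x + M)
    (fun x => by linarith [(abs_le.1 (hf N x)).1]) (fun x => by linarith [(abs_le.1 (hf N x)).2])
  simp_rw [← hshift] at h1
  have i0 : Integrable (fun ω => (bgExp β p N ω (f N) - cwExp β N (f N)) ^ 2)
      (graphMeasure p) := by
    simp_rw [bgExp_eq]
    exact integrable_reducedWeight_comp β p N fun W =>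
      ((∑ x, f N x * W x) / (∑ x, W x) - cwExp β N (f N)) ^ 2
  have hmarkov := mul_meas_ge_le_integral_of_nonneg
    (ae_of_all _ fun ω => sq_nonneg (bgExp β p N ω (f N) - cwExp β N (f N))) i0 (ε ^ 2)
  have hset : {ω | ε ≤ dist (bgExp β p N ω (f N) - cwExp β N (f N)) 0} =
      {ω | ε ^ 2 ≤ (bgExp β p N ω (f N) - cwExp β N (f N)) ^ 2} := by
    ext ω
    simp only [Set.mem_ofPred_eq, Real.dist_0_eq_abs]
    rw [← sq_abs (bgExp β p N ω (f N) - cwExp β N (f N)),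
      pow_le_pow_iff_left₀ hε.le (abs_nonneg _) two_ne_zero]
  rw [hset, le_div_iff₀ (by positivity), mul_comm]
  exact hmarkov.trans h1

end DilutedCurieWeiss

theorem mainTheorem2
    (β : ℝ) (hβ : β < 1)
    (p : ℕ → unitInterval) (hp : ∀ N, 0 < p N)
    (hNp : Tendsto (fun N : ℕ => (N : ℝ) * (p N : ℝ)) atTop atTop)
    (f : ∀ N : ℕ, DilutedCurieWeiss.Config N → ℝ)
    (M : ℝ) (hf : ∀ N x, |f N x| < M)
    (hpos : ∃ a : ℝ,
      Tendsto (fun N => DilutedCurieWeiss.cwExp β N (fun x => (f N x)⁺)) atTop (𝓝 a))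
    (hneg : ∃ b : ℝ,
      Tendsto (fun N => DilutedCurieWeiss.cwExp β N (fun x => (f N x)⁻)) atTop (𝓝 b)) :
    ∃ L : ℝ,
      Tendsto (fun N => DilutedCurieWeiss.cwExp β N (f N)) atTop (𝓝 L) ∧
      TendstoInMeasure (DilutedCurieWeiss.graphMeasure p)
        (fun N ω => DilutedCurieWeiss.bgExp β p N ω (f N)) atTop (fun _ => L) := by
  obtain ⟨a, ha⟩ := hpos
  obtain ⟨b, hb⟩ := hneg
  have hL : Tendsto (fun N => DilutedCurieWeiss.cwExp β N (f N)) atTop (𝓝 (a - b)) := by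
    refine (ha.sub hb).congr fun N => ?_
    simp only [DilutedCurieWeiss.cwExp, ← Finset.sum_sub_distrib, ← sub_mul, posPart_sub_negPart]
  refine ⟨a - b, hL, ?_⟩
  have h := DilutedCurieWeiss.tendstoInMeasure_bgExp_sub_cwExp hβ hNp fun N x => (hf N x).le
  rw [tendstoInMeasure_iff_measureReal_dist] at h ⊢
  intro ε hε
  refine squeeze_zero' (Eventually.of_forall fun _ => measureReal_nonneg) ?_
    (h (ε / 2) (half_pos hε))
  filter_upwards [Metric.tendsto_nhds.1 hL (ε / 2) (half_pos hε)] with N hN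
  refine measureReal_mono fun ω hω => ?_
  simp only [Set.mem_ofPred_eq] at hω ⊢
  rw [Real.dist_eq] at hN hω
  rw [Real.dist_0_eq_abs]
  have := abs_sub_le (DilutedCurieWeiss.bgExp β p N ω (f N)) (DilutedCurieWeiss.cwExp β N (f N))
    (a - b)
  linarith
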